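/- Let $A,B$ be quantum systems of finite dimensions $d_A,d_B\ge 2$, put $n=\min\{d_A,d_B\}$, and for $\alpha,\beta,\gamma\in\mathbb{R}$ let $\Phi=\Phi[\alpha,\beta,\gamma]$ be the linear map on operators $X$ on $\mathbb{C}^{d_A}\otimes\mathbb{C}^{d_B}$ given by $$\Phi[\alpha,\beta,\gamma](X)=(\operatorname{Tr}X)\,\mathbb{1}_{AB}+\alpha\,\mathbb{1}_A\otimes \operatorname{Tr}_A X+\beta\,(\operatorname{Tr}_B X)\otimes\mathbb{1}_B+\gamma X .$$ A linear map on such operators is positive if it sends positive semidefinite operators to positive semidefinite operators. It is PPT-inducing if its composition $(I_A\otimes T_B)\circ\Phi$ with the partial transposition is positive. It is entanglement-annihilating if it is positive and sends every state (positive semidefinite operator of trace one) to a separable operator, where an operator is separable if it is a finite sum $\sum_i P_i\otimes Q_i$ with all $P_i,Q_i$ positive semidefinite (no normalization is required). The following are equivalent: 1. $\Phi$ is entanglement-annihilating; 2. $\Phi$ is positive and PPT-inducing; 3. $\Phi$ is positive and $\gamma\le\alpha+\beta+2$; 4. $\alpha\ge-1$, $\beta\ge-1$, $\gamma+\frac{\alpha+\beta}{n}+1\ge0$,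 $\alpha+\beta+\gamma+1\ge0$ and $\gamma\le\alpha+\beta+2$. Moreover, for every unit vector $\Psi\in\mathbb{C}^{d_A}\otimes\mathbb{C}^{d_B}$ with reduced states $\rho_A=\operatorname{Tr}_B|\Psi\rangle\langle\Psi|$ and $\rho_B=\operatorname{Tr}_A|\Psi\rangle\langle\Psi|$, the operator $$2\,\mathbb{1}_{AB}-2\,\mathbb{1}_A\otimes\rho_B-\rho_A\otimes\mathbb{1}_B+|\Psi\rangle\langle\Psi|$$ is separable. -/

import Mathlib

open scoped Kronecker Matrix ComplexOrder

noncomputable section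

namespace Bipartite

/-- Operators on the bipartite system `AB`, as matrices in a product basis. -/
abbrev Op (A B : Type*) := Matrix (A × B) (A × B) ℂ

variable {A B : Type*} [Fintype A] [Fintype B] [DecidableEq A] [DecidableEq B]

/-- Partial trace over the first system, `Tr_A : Op A B → Op B`. -/
def traceA (X : Op A B) : Matrix B B ℂ :=
  Matrix.of fun b b' => ∑ a, X (a, b) (a, b')

/-- Partial trace over the second system, `Tr_B : Op A B → Op A`. -/
def traceB (X : Op A B) : Matrix A A ℂ :=
  Matrix.of fun a a' => ∑ b, X (a, b) (a', b)

/-- The map `𝟙_{AB} Tr : X ↦ (Tr X) 𝟙_{AB}`. -/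
def depolAB : Op A B →ₗ[ℂ] Op A B where
  toFun X := X.trace • (1 : Op A B)
  map_add' X Y := by rw [Matrix.trace_add, add_smul]
  map_smul' c X := by rw [Matrix.trace_smul, smul_assoc, RingHom.id_apply]

/-- The map `(𝟙_A Tr) ⊗ I : X ↦ 𝟙_A ⊗ Tr_A X`. -/
def depolA : Op A B →ₗ[ℂ] Op A B where
  toFun X := (1 : Matrix A A ℂ) ⊗ₖ traceA X
  map_add' X Y := by
    have h : traceA (X + Y) = traceA X + traceA Y := by
      ext b b'
      simp [traceA, Finset.sum_add_distrib]
    rw [h, Matrix.kronecker_add]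
  map_smul' c X := by
    have h : traceA (c • X) = c • traceA X := by
      ext b b'
      simp [traceA, Finset.mul_sum]
    rw [h, Matrix.kronecker_smul, RingHom.id_apply]

/-- The map `I ⊗ (𝟙_B Tr) : X ↦ Tr_B X ⊗ 𝟙_B`. -/
def depolB : Op A B →ₗ[ℂ] Op A B where
  toFun X := traceB X ⊗ₖ (1 : Matrix B B ℂ)
  map_add' X Y := by
    have h : traceB (X + Y) = traceB X + traceB Y := by
      ext a a'
      simp [traceB, Finset.sum_add_distrib]
    rw [h, Matrix.add_kronecker]
  map_smul' c X := by
    have h : traceB (c • X) = c • traceB X := by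
      ext a a'
      simp [traceB, Finset.mul_sum]
    rw [h, Matrix.smul_kronecker, RingHom.id_apply]

/-- `Φ[α,β,γ] = 𝟙_{AB} Tr + α (𝟙_A Tr) ⊗ I + β I ⊗ (𝟙_B Tr) + γ I`. -/
def Phi (A B : Type*) [Fintype A] [Fintype B] [DecidableEq A] [DecidableEq B]
    (α β γ : ℝ) : Op A B →ₗ[ℂ] Op A B :=
  depolAB + (α : ℂ) • depolA + (β : ℂ) • depolB + (γ : ℂ) • LinearMap.id

/-- Partial transposition on the second system, `I_A ⊗ T_B`. -/
def partialTranspose : Op A B →ₗ[ℂ] Op A B where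
  toFun X := Matrix.of fun p q => X (p.1, q.2) (q.1, p.2)
  map_add' _ _ := rfl
  map_smul' _ _ := rfl

/-- A linear map on operators is positive if it preserves positive semidefiniteness. -/
def IsPositiveMap (Ξ : Op A B →ₗ[ℂ] Op A B) : Prop :=
  ∀ X : Op A B, X.PosSemidef → (Ξ X).PosSemidef

/-- A linear map on operators is PPT-inducing if its composition with the partial transposition
is a positive map. -/
def IsPPTInducing (Ξ : Op A B →ₗ[ℂ] Op A B) : Prop :=
  IsPositiveMap (partialTranspose ∘ₗ Ξ)

/-- Quantum states: positive semidefinite operators of trace one. -/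
def IsState (R : Op A B) : Prop :=
  R.PosSemidef ∧ R.trace = 1

/-- Separability of a (not necessarily normalized) operator: it is a finite sum of tensor
products of positive semidefinite operators. -/
def IsSeparable (X : Op A B) : Prop :=
  ∃ (k : ℕ) (P : Fin k → Matrix A A ℂ) (Q : Fin k → Matrix B B ℂ),
    (∀ i, (P i).PosSemidef) ∧ (∀ i, (Q i).PosSemidef) ∧ X = ∑ i, P i ⊗ₖ Q i

/-- A linear map on operators is entanglement-annihilating if it is positive and sends every
state to a separable operator. -/
def IsEntanglementAnnihilating (Ξ : Op A B →ₗ[ℂ] Op A B) : Prop :=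
  IsPositiveMap Ξ ∧ ∀ R : Op A B, IsState R → IsSeparable (Ξ R)

/-- The projector `|Ψ⟩⟨Ψ|`. -/
def ketBra (Ψ : A × B → ℂ) : Op A B :=
  Matrix.vecMulVec Ψ (star Ψ)

end Bipartite

end

/-!
An entanglement-annihilating map is PPT-inducing because separable operators have a positive partial
transpose. The five inequalities on `(α, β, γ)` are necessary by tests on explicit vectors: they are
read off from the images of `|00⟩`, of `∑ |ii⟩` (with `n = min dA dB` terms) and, after partial
transposition, of `|00⟩ + |11⟩` (`Phi_testVec_apply`).

For the sufficiency of the inequalities, a positive semidefinite operator is a sum of operators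
`|Ψ⟩⟨Ψ|`, so it suffices that every `Φ(|Ψ⟩⟨Ψ|)` is separable. In a Schmidt decomposition
`Ψ = ∑ μᵢ uᵢ ⊗ vᵢ` (`exists_schmidt`), with `λᵢ = μᵢ²` and `t = ∑ λᵢ`, the part of
`Φ(|Ψ⟩⟨Ψ|)` outside the span of the `uᵢ ⊗ vⱼ` is a sum of products of positive
operators because `α, β ≥ -1`, and the part inside is
`∑ᵢⱼ (t + α λⱼ + β λᵢ) |uᵢ ⊗ vⱼ⟩⟨uᵢ ⊗ vⱼ| + γ |Ψ⟩⟨Ψ|` (`Phi_ketBra_schmidt`). This is linear in the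
parameters, so only the vertices and extreme rays of the polyhedron they define matter
(`isSeparable_schmidtBlock`): the vertices `(-1, -1/2, 1/2)` and `(-1, 1, -1)`, the rays `(1, 0, 1)`
and `(n, 0, -1)`, and their images under exchange of `α` and `β`.

Each generator is separable by averaging product vectors over phases. The average of
`|x ⊗ y⟩⟨x ⊗ y|` over `x = ∑ ωᵢ uᵢ`, `y = ∑ ω̄ᵢ vᵢ` is the projector onto `∑ uᵢ ⊗ vᵢ` plus the
off-diagonal terms `|uᵢ ⊗ vⱼ⟩⟨uᵢ ⊗ vⱼ|` (`isSeparable_ketBra_add_offDiag`), which gives the rays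
`(1, 0, 1)` and `(0, 1, 1)`. For the other generators the same average is used for every pair of
indices separately, with suitably weighted vectors (`isSeparable_diagonal_add`); for instance, at
the vertices with `α = -1` the pair `{i, j}` contributes the projector onto
`μⱼ uᵢ ⊗ vᵢ ± μᵢ uⱼ ⊗ vⱼ`, and summing these over all pairs yields exactly the off-diagonal part
of `± |Ψ⟩⟨Ψ|` with diagonal coefficients `t - λᵢ`. The separability of
`2 𝟙 - 2 𝟙 ⊗ ρ_B - ρ_A ⊗ 𝟙 + |Ψ⟩⟨Ψ|` is the case of the first vertex.
-/

namespace Bipartite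

/-! ### The cone of separable operators -/

section Cone

variable {A B : Type*}

theorem isSeparable_zero : IsSeparable (0 : Op A B) :=
  ⟨0, fun _ => 0, fun _ => 0, fun i => i.elim0, fun i => i.elim0, by simp⟩

theorem IsSeparable.add {X Y : Op A B} (hX : IsSeparable X) (hY : IsSeparable Y) :
    IsSeparable (X + Y) := by
  obtain ⟨k, P, Q, hP, hQ, rfl⟩ := hX
  obtain ⟨l, P', Q', hP', hQ', rfl⟩ := hY
  refine ⟨k + l, Fin.append P P', Fin.append Q Q', fun i => ?_, fun i => ?_, ?_⟩
  · induction i using Fin.addCases <;> simp [hP, hP']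
  · induction i using Fin.addCases <;> simp [hQ, hQ']
  · simp [Fin.sum_univ_add]

theorem isSeparable_sum {ι : Type*} (s : Finset ι) {X : ι → Op A B}
    (h : ∀ i ∈ s, IsSeparable (X i)) : IsSeparable (∑ i ∈ s, X i) :=
  Finset.sum_induction X IsSeparable (fun _ _ => IsSeparable.add) isSeparable_zero h

theorem isSeparable_kronecker {P : Matrix A A ℂ} {Q : Matrix B B ℂ} (hP : P.PosSemidef)
    (hQ : Q.PosSemidef) : IsSeparable (P ⊗ₖ Q) :=
  ⟨1, fun _ => P, fun _ => Q, fun _ => hP, fun _ => hQ, by simp⟩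

theorem IsSeparable.smul {X : Op A B} (hX : IsSeparable X) {c : ℝ} (hc : 0 ≤ c) :
    IsSeparable ((c : ℂ) • X) := by
  obtain ⟨k, P, Q, hP, hQ, rfl⟩ := hX
  refine ⟨k, fun i => (c : ℂ) • P i, Q, fun i => (hP i).smul (by exact_mod_cast hc), hQ, ?_⟩
  simp [Finset.smul_sum, Matrix.smul_kronecker]

theorem IsSeparable.of_smul {X : Op A B} {c : ℝ} (hc : 0 < c)
    (hX : IsSeparable ((c : ℂ) • X)) : IsSeparable X := by
  have h := hX.smul (inv_nonneg.2 hc.le)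
  rwa [smul_smul, ← Complex.ofReal_mul, inv_mul_cancel₀ hc.ne', Complex.ofReal_one, one_smul] at h

theorem partialTranspose_kronecker (P : Matrix A A ℂ) (Q : Matrix B B ℂ) :
    partialTranspose (P ⊗ₖ Q) = P ⊗ₖ Qᵀ := by
  ext ⟨a, b⟩ ⟨a', b'⟩
  rfl

theorem IsSeparable.partialTranspose {X : Op A B} (hX : IsSeparable X) :
    IsSeparable (partialTranspose X) := by
  obtain ⟨k, P, Q, hP, hQ, rfl⟩ := hX
  exact ⟨k, P, fun i => (Q i)ᵀ, hP, fun i => (hQ i).transpose,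
    by simp [map_sum, partialTranspose_kronecker]⟩

variable [Fintype A] [Fintype B]

theorem IsSeparable.posSemidef {X : Op A B} (hX : IsSeparable X) : X.PosSemidef := by
  classical
  obtain ⟨k, P, Q, hP, hQ, rfl⟩ := hX
  exact Matrix.posSemidef_sum _ fun i _ => (hP i).kronecker (hQ i)

end Cone

/-! ### Averaging over phases -/

section Phases

variable {A B : Type*}

/-- The product vector `u ⊗ v`. -/
def prodVec (u : A → ℂ) (v : B → ℂ) : A × B → ℂ := fun p => u p.1 * v p.2

/-- The rank-one operator `|u⟩⟨u|` on a single system. -/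
def proj (u : A → ℂ) : Matrix A A ℂ := Matrix.vecMulVec u (star u)

theorem ketBra_prodVec (u : A → ℂ) (v : B → ℂ) :
    ketBra (prodVec u v) = proj u ⊗ₖ proj v := by
  ext ⟨a, b⟩ ⟨a', b'⟩
  simp [ketBra, prodVec, proj, Matrix.vecMulVec_apply, Matrix.kroneckerMap_apply]
  ring

theorem zero_prodVec (v : B → ℂ) : prodVec (0 : A → ℂ) v = 0 := by
  ext
  simp [prodVec]

theorem prodVec_zero (u : A → ℂ) : prodVec u (0 : B → ℂ) = 0 := by
  ext
  simp [prodVec]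

theorem smul_prodVec (c : ℂ) (u : A → ℂ) (v : B → ℂ) : prodVec (c • u) v = c • prodVec u v := by
  ext
  simp [prodVec, mul_assoc]

theorem prodVec_smul (c : ℂ) (u : A → ℂ) (v : B → ℂ) : prodVec u (c • v) = c • prodVec u v := by
  ext
  simp [prodVec, mul_left_comm]

theorem ketBra_zero : ketBra (0 : A × B → ℂ) = 0 := by
  ext
  simp [ketBra, Matrix.vecMulVec_apply]

theorem ketBra_smul (c : ℝ) (ξ : A × B → ℂ) :
    ketBra ((c : ℂ) • ξ) = ((c ^ 2 : ℝ) : ℂ) • ketBra ξ := by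
  ext p q
  simp [ketBra, Matrix.vecMulVec_apply]
  ring

theorem posSemidef_proj [Fintype A] (u : A → ℂ) : (proj u).PosSemidef :=
  Matrix.posSemidef_vecMulVec_self_star u

theorem isSeparable_ketBra_prodVec [Fintype A] [Fintype B] (u : A → ℂ) (v : B → ℂ) :
    IsSeparable (ketBra (prodVec u v)) := by
  rw [ketBra_prodVec]
  exact isSeparable_kronecker (posSemidef_proj u) (posSemidef_proj v)

/-- Averaging `ξ + ω a + ω̄ b` over the fourth roots of unity `ω` removes all cross terms,
since `ω`, `ω̄` and `ω²` average to zero. -/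
theorem sum_ketBra_phase (ξ a b : A × B → ℂ) :
    ∑ k : Fin 4, ketBra (ξ + Complex.I ^ (k : ℕ) • a + star (Complex.I ^ (k : ℕ)) • b) =
      (4 : ℂ) • (ketBra ξ + ketBra a + ketBra b) := by
  ext p q
  simp only [Fin.sum_univ_four, ketBra, Matrix.add_apply, Matrix.vecMulVec_apply, Pi.add_apply,
    Pi.smul_apply, Pi.star_apply, star_add, star_mul', star_pow, smul_eq_mul,
    Matrix.smul_apply, RCLike.star_def, Complex.conj_I, map_neg, neg_neg, Fin.val_zero,
    Fin.val_one, Fin.val_two]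
  have h3 : ((3 : Fin 4) : ℕ) = 3 := rfl
  have hI : Complex.I ^ 2 = -1 := Complex.I_sq
  rw [h3]
  ring_nf
  have hI3 : Complex.I ^ 3 = -Complex.I := Complex.I_pow_three
  have hI4 : Complex.I ^ 4 = 1 := Complex.I_pow_four
  have hI6 : Complex.I ^ 6 = -1 := by rw [show 6 = 4 + 2 from rfl, pow_add, hI4, hI, one_mul]
  simp only [hI, hI3, hI4, hI6]
  ring

/-- Product vectors with a phase on one new summand of each factor. -/
theorem prodVec_phase (ω : ℂ) (hω : ω * star ω = 1) (U u : A → ℂ) (V v : B → ℂ) :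
    prodVec (U + ω • u) (V + star ω • v) =
      (prodVec U V + prodVec u v) + ω • prodVec u V + star ω • prodVec U v := by
  ext p
  simp only [prodVec, Pi.add_apply, Pi.smul_apply, smul_eq_mul]
  linear_combination u p.1 * v p.2 * hω

theorem I_pow_mul_star (k : ℕ) : Complex.I ^ k * star (Complex.I ^ k) = 1 := by
  rw [star_pow, ← mul_pow]
  simp

/-- For any families of vectors, the projector onto `U ⊗ V + ∑ᵢ uᵢ ⊗ vᵢ` becomes separable once the
projectors onto all the off-diagonal products `U ⊗ vᵢ`, `uᵢ ⊗ V` and `uᵢ ⊗ vⱼ` with `i ≠ j` are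
added: the sum is the average of `|x ⊗ y⟩⟨x ⊗ y|` over `x = U + ∑ ωᵢ uᵢ` and `y = V + ∑ ω̄ᵢ vᵢ` with
independent phases `ωᵢ`, taken here one phase at a time. -/
theorem isSeparable_ketBra_add_offDiag [Fintype A] [Fintype B] {ι : Type*} [DecidableEq ι]
    (u : ι → A → ℂ) (v : ι → B → ℂ) (s : Finset ι) (U : A → ℂ) (V : B → ℂ) :
    IsSeparable (ketBra (prodVec U V + ∑ i ∈ s, prodVec (u i) (v i))
      + ∑ i ∈ s, (ketBra (prodVec U (v i)) + ketBra (prodVec (u i) V))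
      + ∑ i ∈ s, ∑ j ∈ s, if i = j then 0 else ketBra (prodVec (u i) (v j))) := by
  induction s using Finset.induction_on generalizing U V with
  | empty => simpa using isSeparable_ketBra_prodVec U V
  | insert k s hk ih =>
    have key := isSeparable_sum Finset.univ fun (m : Fin 4) _ =>
      ih (U + Complex.I ^ (m : ℕ) • u k) (V + star (Complex.I ^ (m : ℕ)) • v k)
    refine IsSeparable.of_smul (c := 4) (by norm_num) ?_
    convert key using 1
    have h1 : ∀ m : ℕ, prodVec (U + Complex.I ^ m • u k) (V + star (Complex.I ^ m) • v k)
        + ∑ i ∈ s, prodVec (u i) (v i) =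
        (prodVec U V + (prodVec (u k) (v k) + ∑ i ∈ s, prodVec (u i) (v i)))
          + Complex.I ^ m • prodVec (u k) V + star (Complex.I ^ m) • prodVec U (v k) := by
      intro m
      rw [prodVec_phase _ (I_pow_mul_star m)]
      abel
    have h2 : ∀ (m : ℕ) i, prodVec (U + Complex.I ^ m • u k) (v i) =
        prodVec U (v i) + Complex.I ^ m • prodVec (u k) (v i) + star (Complex.I ^ m) • 0 := by
      intro m i
      ext p
      simp [prodVec]
      ring
    have h3 : ∀ (m : ℕ) i, prodVec (u i) (V + star (Complex.I ^ m) • v k) =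
        prodVec (u i) V + Complex.I ^ m • 0 + star (Complex.I ^ m) • prodVec (u i) (v k) := by
      intro m i
      ext p
      simp [prodVec]
      ring
    have hk1 : ∀ i ∈ s, (if i = k then 0 else ketBra (prodVec (u i) (v k))) =
        ketBra (prodVec (u i) (v k)) := fun i hi => if_neg (by rintro rfl; exact hk hi)
    have hk2 : ∀ i ∈ s, (if k = i then 0 else ketBra (prodVec (u k) (v i))) =
        ketBra (prodVec (u k) (v i)) := fun i hi => if_neg (by rintro rfl; exact hk hi)
    simp only [h1, h2, h3, Finset.sum_add_distrib, sum_ketBra_phase]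
    simp_rw [Finset.sum_comm (s := Finset.univ) (t := s), sum_ketBra_phase]
    simp only [Finset.sum_insert hk, Finset.sum_add_distrib, if_true, ketBra_zero, Finset.sum_const,
      Finset.card_univ, Fintype.card_fin, ← Finset.smul_sum, Finset.sum_congr rfl hk1,
      Finset.sum_congr rfl hk2]
    push_cast
    module

end Phases

/-! ### Schmidt decomposition -/

section Schmidt

variable {A B ι : Type*} [DecidableEq ι]

/-- Orthonormality of a finite family of vectors of `ℂ^A`, with respect to the standard
inner product. -/
def IsOrthonormal [Fintype A] (u : ι → A → ℂ) : Prop :=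
  ∀ i j, star (u i) ⬝ᵥ u j = if i = j then 1 else 0

theorem IsOrthonormal.conjTranspose_mul_self [Fintype A] {u : ι → A → ℂ} (hu : IsOrthonormal u) :
    (Matrix.of fun a i => u i a)ᴴ * (Matrix.of fun a i => u i a) = 1 := by
  ext i j
  simpa [Matrix.mul_apply, dotProduct, Matrix.one_apply] using hu i j

theorem IsOrthonormal.card_le [Fintype A] [Fintype ι] {u : ι → A → ℂ} (hu : IsOrthonormal u) :
    Fintype.card ι ≤ Fintype.card A := by
  have h := Matrix.rank_mul_le_right (Matrix.of fun a i => u i a)ᴴ (Matrix.of fun a i => u i a)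
  rw [hu.conjTranspose_mul_self, Matrix.rank_one] at h
  exact h.trans (Matrix.rank_le_card_height _)

/-- The projector onto the orthogonal complement of an orthonormal family is positive
semidefinite. -/
theorem IsOrthonormal.posSemidef_compl [Fintype A] [Fintype ι] [DecidableEq A]
    {u : ι → A → ℂ} (hu : IsOrthonormal u) :
    (1 - ∑ i, proj (u i)).PosSemidef := by
  set G : Matrix A ι ℂ := Matrix.of fun a i => u i a with hG
  have h1 : ∑ i, proj (u i) = G * Gᴴ := by
    ext a a'
    simp [hG, proj, Matrix.sum_apply, Matrix.mul_apply, Matrix.vecMulVec_apply]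
  have h2 : Gᴴ * G = 1 := hu.conjTranspose_mul_self
  have h3 : (1 - G * Gᴴ)ᴴ * (1 - G * Gᴴ) = 1 - G * Gᴴ := by
    have h4 : G * Gᴴ * (G * Gᴴ) = G * Gᴴ := by
      rw [Matrix.mul_assoc, ← Matrix.mul_assoc Gᴴ, h2, Matrix.one_mul]
    simp only [Matrix.conjTranspose_sub, Matrix.conjTranspose_one, Matrix.conjTranspose_mul,
      Matrix.conjTranspose_conjTranspose, Matrix.sub_mul, Matrix.mul_sub, Matrix.one_mul,
      Matrix.mul_one, h4]
    abel
  rw [h1, ← h3]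
  exact Matrix.posSemidef_conjTranspose_mul_self _

theorem traceA_schmidt [Fintype A] [Fintype ι] {u : ι → A → ℂ} (hu : IsOrthonormal u)
    (v : ι → B → ℂ) (μ : ι → ℝ) :
    traceA (ketBra (∑ i, (μ i : ℂ) • prodVec (u i) (v i))) =
      ∑ i, ((μ i ^ 2 : ℝ) : ℂ) • proj (v i) := by
  ext b b'
  have h : ∀ i j, ∑ a, u i a * star (u j a) = if j = i then 1 else 0 := fun i j => by
    rw [← hu j i]
    simp [dotProduct, mul_comm]
  calc traceA (ketBra (∑ i, (μ i : ℂ) • prodVec (u i) (v i))) b b'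
      = ∑ a, ∑ i, ∑ j, (μ i * v i b * (μ j * star (v j b'))) * (u i a * star (u j a)) := by
        simp only [traceA, ketBra, Matrix.of_apply, Matrix.vecMulVec_apply, Finset.sum_apply,
          Pi.star_apply, star_sum, Finset.sum_mul_sum, prodVec, Pi.smul_apply, smul_eq_mul,
          star_mul', RCLike.star_def, Complex.conj_ofReal]
        refine Finset.sum_congr rfl fun a _ => Finset.sum_congr rfl fun i _ =>
          Finset.sum_congr rfl fun j _ => ?_
        ring
    _ = ∑ i, ∑ j, (μ i * v i b * (μ j * star (v j b'))) * (if j = i then 1 else 0) := by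
        rw [Finset.sum_comm]
        refine Finset.sum_congr rfl fun i _ => ?_
        rw [Finset.sum_comm]
        refine Finset.sum_congr rfl fun j _ => ?_
        rw [← Finset.mul_sum, h]
    _ = _ := by
        simp only [mul_ite, mul_one, mul_zero, Finset.sum_ite_eq', Finset.mem_univ, if_true,
          Matrix.sum_apply, Matrix.smul_apply, proj, Matrix.vecMulVec_apply, Pi.star_apply,
          smul_eq_mul]
        refine Finset.sum_congr rfl fun i _ => ?_
        push_cast
        ring

theorem traceB_schmidt [Fintype B] [Fintype ι] (u : ι → A → ℂ) {v : ι → B → ℂ}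
    (hv : IsOrthonormal v) (μ : ι → ℝ) :
    traceB (ketBra (∑ i, (μ i : ℂ) • prodVec (u i) (v i))) =
      ∑ i, ((μ i ^ 2 : ℝ) : ℂ) • proj (u i) := by
  rw [← traceA_schmidt hv u μ]
  ext a a'
  simp [traceA, traceB, ketBra, Matrix.vecMulVec_apply, prodVec, mul_comm]

theorem trace_proj_eq_one [Fintype A] {u : ι → A → ℂ} (hu : IsOrthonormal u) (i : ι) :
    (proj (u i)).trace = 1 := by
  rw [proj, Matrix.trace_vecMulVec, dotProduct_comm, hu i i, if_pos rfl]

theorem trace_traceA {A B : Type*} [Fintype A] [Fintype B] (X : Op A B) :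
    (traceA X).trace = X.trace := by
  simp only [traceA, Matrix.trace, Matrix.diag_apply, Matrix.of_apply, Fintype.sum_prod_type]
  exact Finset.sum_comm

theorem trace_schmidt [Fintype A] [Fintype B] [Fintype ι]
    {u : ι → A → ℂ} (hu : IsOrthonormal u) {v : ι → B → ℂ}
    (hv : IsOrthonormal v) (μ : ι → ℝ) :
    (ketBra (∑ i, (μ i : ℂ) • prodVec (u i) (v i))).trace = ((∑ i, μ i ^ 2 : ℝ) : ℂ) := by
  rw [← trace_traceA, traceA_schmidt hu v μ, Matrix.trace_sum]
  simp [Matrix.trace_smul, trace_proj_eq_one hv]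

/-- **Schmidt decomposition**, from the spectral theorem for `Mᴴ * M` where `M` is the matrix of
coefficients of `Ψ`. -/
theorem exists_schmidt {A B : Type*} [Fintype A] [Fintype B] [DecidableEq B] (Ψ : A × B → ℂ) :
    ∃ (s : Finset B) (μ : s → ℝ) (u : s → A → ℂ) (v : s → B → ℂ),
      IsOrthonormal u ∧ IsOrthonormal v ∧ Ψ = ∑ i, (μ i : ℂ) • prodVec (u i) (v i) := by
  set M : Matrix A B ℂ := Matrix.of fun a b => Ψ (a, b) with hMdef
  have hM := Matrix.isHermitian_conjTranspose_mul_self M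
  set lam := hM.eigenvalues with hlam
  have hlam0 : ∀ k, 0 ≤ lam k := Matrix.eigenvalues_conjTranspose_mul_self_nonneg M
  set W : Matrix B B ℂ := (hM.eigenvectorUnitary : Matrix B B ℂ) with hW
  have hWW : W * Wᴴ = 1 := Unitary.coe_mul_star_self hM.eigenvectorUnitary
  have hWW' : Wᴴ * W = 1 := Unitary.coe_star_mul_self hM.eigenvectorUnitary
  set N := M * W with hN
  have hNN : Nᴴ * N = Matrix.diagonal (fun k => (lam k : ℂ)) := by
    have h := hM.conjStarAlgAut_star_eigenvectorUnitary
    rw [Unitary.conjStarAlgAut_star_apply] at h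
    rw [hN, Matrix.conjTranspose_mul, Matrix.mul_assoc, ← Matrix.mul_assoc Mᴴ, ← Matrix.mul_assoc]
    exact h
  have hMN : M = N * Wᴴ := by rw [hN, Matrix.mul_assoc, hWW, Matrix.mul_one]
  have hcol : ∀ k l, ∑ a, star (N a k) * N a l = if k = l then (lam k : ℂ) else 0 := fun k l => by
    have := congrFun (congrFun hNN k) l
    simpa [Matrix.mul_apply, Matrix.diagonal_apply] using this
  -- The columns of `N` are orthogonal with squared norms `lam k`; those with `lam k = 0` vanish.
  have hzero : ∀ k, lam k = 0 → ∀ a, N a k = 0 := by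
    intro k hk a
    have h := hcol k k
    rw [if_pos rfl, hk, Complex.ofReal_zero,
      Finset.sum_eq_zero_iff_of_nonneg fun a _ => star_mul_self_nonneg _] at h
    simpa using h a (Finset.mem_univ a)
  refine ⟨Finset.univ.filter fun k => lam k ≠ 0, fun k => √(lam k),
    fun k a => (√(lam k) : ℂ)⁻¹ * N a k, fun k b => star (W b k), ?_, ?_, ?_⟩
  · intro k l
    have hk : lam k ≠ 0 := (Finset.mem_filter.1 k.2).2
    have hs : (√(lam k) : ℂ) ≠ 0 := by
      exact_mod_cast (Real.sqrt_pos.2 (lt_of_le_of_ne (hlam0 k) hk.symm)).ne'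
    have hsq : (√(lam k) : ℂ) * √(lam k) = lam k := by
      exact_mod_cast Real.mul_self_sqrt (hlam0 k)
    have : star (fun a => (√(lam k) : ℂ)⁻¹ * N a k) ⬝ᵥ (fun a => (√(lam l) : ℂ)⁻¹ * N a l) =
        (√(lam k) : ℂ)⁻¹ * (√(lam l) : ℂ)⁻¹ * ∑ a, star (N a k) * N a l := by
      rw [Finset.mul_sum]
      refine Finset.sum_congr rfl fun a _ => ?_
      simp
      ring
    rw [this, hcol]
    by_cases h : k = l
    · subst h
      rw [if_pos rfl, if_pos rfl, ← hsq]
      field_simp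
    · rw [if_neg h, if_neg (fun h' => h (Subtype.ext h')), mul_zero]
  · intro k l
    have := congrFun (congrFun hWW' l) k
    simp only [Matrix.mul_apply, Matrix.one_apply, Matrix.conjTranspose_apply] at this
    simp only [dotProduct, Pi.star_apply, star_star]
    simp_rw [mul_comm (W _ (k : B)), this, eq_comm (a := (l : B)), Subtype.ext_iff]
  · ext ⟨a, b⟩
    have h1 : Ψ (a, b) = ∑ k, N a k * star (W b k) := by
      have := congrFun (congrFun hMN a) b
      exact this
    have h2 : ∑ k, N a k * star (W b k) =
        ∑ k ∈ Finset.univ.filter fun k => lam k ≠ 0, N a k * star (W b k) := by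
      symm
      refine Finset.sum_filter_of_ne fun k _ hk h => hk ?_
      rw [hzero k h, zero_mul]
    rw [h1, h2, ← Finset.sum_coe_sort, Finset.sum_apply]
    refine Finset.sum_congr rfl fun k _ => ?_
    have hk : lam k ≠ 0 := (Finset.mem_filter.1 k.2).2
    have hs : (√(lam k) : ℂ) ≠ 0 := by
      exact_mod_cast (Real.sqrt_pos.2 (lt_of_le_of_ne (hlam0 k) hk.symm)).ne'
    simp only [Pi.smul_apply, prodVec, smul_eq_mul]
    field_simp

end Schmidt

/-! ### Separability of operators diagonal up to a multiple of the projector -/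

section SchmidtDiagonal

variable {A B ι : Type*} [Fintype ι]

/-- The sum over unordered pairs `{i, j}` of the operators obtained by averaging the product vector
`(aᵢⱼ uᵢ + ω ε aⱼᵢ uⱼ) ⊗ (bᵢⱼ vᵢ + ω̄ bⱼᵢ vⱼ)` over phases `ω`, written as a sum over ordered
pairs. -/
theorem isSeparable_pairs [Fintype A] [Fintype B] [DecidableEq ι]
    (u : ι → A → ℂ) (v : ι → B → ℂ) (μ : ι → ℝ) {ε : ℝ} (hε : ε ^ 2 = 1)
    (a b : ι → ι → ℝ) (h : ∀ i j, i ≠ j → a i j * b i j * (a j i * b j i) = μ i * μ j) :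
    IsSeparable (∑ i, ∑ j, if i = j then 0 else
      ((((a i j * b i j) ^ 2 : ℝ) : ℂ) • ketBra (prodVec (u i) (v i))
        + ((ε * (μ i * μ j) : ℝ) : ℂ) •
          Matrix.vecMulVec (prodVec (u i) (v i)) (star (prodVec (u j) (v j)))
        + (((a i j * b j i) ^ 2 : ℝ) : ℂ) • ketBra (prodVec (u i) (v j)))) := by
  set f : ι → ι → Op A B := fun i j => if i = j then 0 else
      ((((a i j * b i j) ^ 2 : ℝ) : ℂ) • ketBra (prodVec (u i) (v i))
        + ((ε * (μ i * μ j) : ℝ) : ℂ) •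
          Matrix.vecMulVec (prodVec (u i) (v i)) (star (prodVec (u j) (v j)))
        + (((a i j * b j i) ^ 2 : ℝ) : ℂ) • ketBra (prodVec (u i) (v j))) with hf
  have key : ∀ i j, IsSeparable (f i j + f j i) := by
    intro i j
    by_cases hij : i = j
    · simpa [hf, hij] using isSeparable_zero
    have := isSeparable_ketBra_add_offDiag (fun _ : Unit => ((ε * a j i : ℝ) : ℂ) • u j)
      (fun _ => ((b j i : ℝ) : ℂ) • v j) {()} (((a i j : ℝ) : ℂ) • u i) (((b i j : ℝ) : ℂ) • v i)
    convert this using 1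
    have hε' : (ε : ℂ) ^ 2 = 1 := by exact_mod_cast hε
    have h' : (a i j * b i j * (a j i * b j i) : ℂ) = μ i * μ j := by exact_mod_cast h i j hij
    ext p q
    simp only [hf, if_neg hij, if_neg (Ne.symm hij), Finset.sum_singleton, if_true, ketBra,
      Matrix.add_apply, Matrix.smul_apply, Matrix.vecMulVec_apply, Pi.add_apply, Pi.star_apply,
      prodVec, Pi.smul_apply, smul_eq_mul, star_add, star_mul', RCLike.star_def,
      Complex.conj_ofReal, Matrix.zero_apply]
    push_cast
    linear_combination
      (-(a j i * b j i : ℂ) ^ 2 * (u j p.1 * v j p.2)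
          * (starRingEnd ℂ (u j q.1) * starRingEnd ℂ (v j q.2))
        - (a j i * b i j : ℂ) ^ 2 * (u j p.1 * v i p.2)
          * (starRingEnd ℂ (u j q.1) * starRingEnd ℂ (v i q.2))) * hε'
      - ε * (u i p.1 * v i p.2 * (starRingEnd ℂ (u j q.1) * starRingEnd ℂ (v j q.2))
        + u j p.1 * v j p.2 * (starRingEnd ℂ (u i q.1) * starRingEnd ℂ (v i q.2))) * h'
  refine IsSeparable.of_smul (c := 2) (by norm_num) ?_
  have hsum : ((2 : ℝ) : ℂ) • ∑ i, ∑ j, f i j = ∑ i, ∑ j, (f i j + f j i) := by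
    simp only [Finset.sum_add_distrib]
    rw [Finset.sum_comm (f := fun i j => f j i)]
    push_cast
    module
  rw [hsum]
  exact isSeparable_sum _ fun i _ => isSeparable_sum _ fun j _ => key i j

theorem ketBra_sum (u : ι → A → ℂ) (v : ι → B → ℂ) (μ : ι → ℝ) :
    ketBra (∑ i, (μ i : ℂ) • prodVec (u i) (v i)) = ∑ i, ∑ j, ((μ i * μ j : ℝ) : ℂ) •
      Matrix.vecMulVec (prodVec (u i) (v i)) (star (prodVec (u j) (v j))) := by
  ext p q
  simp only [ketBra, Matrix.vecMulVec_apply, Finset.sum_apply, Pi.star_apply, star_sum,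
    Finset.sum_mul_sum, Pi.smul_apply, smul_eq_mul, star_mul', RCLike.star_def,
    Complex.conj_ofReal, Matrix.sum_apply, Matrix.smul_apply]
  refine Finset.sum_congr rfl fun i _ => Finset.sum_congr rfl fun j _ => ?_
  push_cast
  ring

/-- A criterion for the separability of `∑ cᵢⱼ |uᵢ ⊗ vⱼ⟩⟨uᵢ ⊗ vⱼ| ± |Ψ⟩⟨Ψ|`, where
`Ψ = ∑ μᵢ uᵢ ⊗ vᵢ`: the coefficients `cᵢⱼ` dominate those of a sum of phase averages over pairs
of indices. -/
theorem isSeparable_diagonal_add [Fintype A] [Fintype B] [DecidableEq ι]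
    (u : ι → A → ℂ) (v : ι → B → ℂ) (μ : ι → ℝ) {ε : ℝ}
    (hε : ε ^ 2 = 1) (a b c : ι → ι → ℝ)
    (h : ∀ i j, i ≠ j → a i j * b i j * (a j i * b j i) = μ i * μ j)
    (hoff : ∀ i j, i ≠ j → (a i j * b j i) ^ 2 ≤ c i j)
    (hdiag : ∀ i, ∑ j, (a i j * b i j) ^ 2 - (a i i * b i i) ^ 2 ≤ c i i + ε * μ i ^ 2) :
    IsSeparable (∑ i, ∑ j, (c i j : ℂ) • ketBra (prodVec (u i) (v j))
      + (ε : ℂ) • ketBra (∑ i, (μ i : ℂ) • prodVec (u i) (v i))) := by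
  set y : ι → ℝ := fun i => ∑ j, (a i j * b i j) ^ 2 - (a i i * b i i) ^ 2 with hy
  set R : ι → ι → ℝ := fun i j =>
    if i = j then c i i + ε * μ i ^ 2 - y i else c i j - (a i j * b j i) ^ 2 with hR
  have hR0 : ∀ i j, 0 ≤ R i j := by
    intro i j
    by_cases hij : i = j
    · subst hij
      simpa only [hR, if_true, sub_nonneg] using hdiag i
    · simpa [hR, hij] using hoff i j hij
  have hres : IsSeparable (∑ i, ∑ j, (R i j : ℂ) • ketBra (prodVec (u i) (v j))) :=
    isSeparable_sum _ fun i _ => isSeparable_sum _ fun j _ =>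
      (isSeparable_ketBra_prodVec _ _).smul (hR0 i j)
  convert hres.add (isSeparable_pairs u v μ hε a b h) using 1
  rw [ketBra_sum, Finset.smul_sum, ← Finset.sum_add_distrib, ← Finset.sum_add_distrib]
  refine Finset.sum_congr rfl fun i _ => ?_
  -- The coefficients of `|uᵢ ⊗ vᵢ⟩⟨uᵢ ⊗ vᵢ|` from all the pairs `{i, j}` are collected in `y i`.
  have hyi : ∑ j, (if i = j then (0 : Op A B) else
      (((a i j * b i j) ^ 2 : ℝ) : ℂ) • ketBra (prodVec (u i) (v i))) =
      ∑ j, if i = j then (y i : ℂ) • ketBra (prodVec (u i) (v i)) else 0 := by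
    have h1 : ∀ j, (if i = j then (0 : Op A B) else
        (((a i j * b i j) ^ 2 : ℝ) : ℂ) • ketBra (prodVec (u i) (v i))) =
        (((a i j * b i j) ^ 2 : ℝ) : ℂ) • ketBra (prodVec (u i) (v i)) -
        if i = j then (((a i i * b i i) ^ 2 : ℝ) : ℂ) • ketBra (prodVec (u i) (v i)) else 0 := by
      intro j
      by_cases hij : i = j
      · subst hij
        simp
      · simp [hij]
    simp only [h1, Finset.sum_sub_distrib, Finset.sum_ite_eq, Finset.mem_univ, if_true, hy,
      ← Finset.sum_smul, Complex.ofReal_sub, Complex.ofReal_sum, sub_smul]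
  have h2 : ∀ j, (if i = j then (0 : Op A B) else
      ((((a i j * b i j) ^ 2 : ℝ) : ℂ) • ketBra (prodVec (u i) (v i))
        + ((ε * (μ i * μ j) : ℝ) : ℂ) •
          Matrix.vecMulVec (prodVec (u i) (v i)) (star (prodVec (u j) (v j)))
        + (((a i j * b j i) ^ 2 : ℝ) : ℂ) • ketBra (prodVec (u i) (v j)))) =
      (if i = j then (0 : Op A B) else
        (((a i j * b i j) ^ 2 : ℝ) : ℂ) • ketBra (prodVec (u i) (v i))) +
      (if i = j then (0 : Op A B) else ((ε * (μ i * μ j) : ℝ) : ℂ) •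
          Matrix.vecMulVec (prodVec (u i) (v i)) (star (prodVec (u j) (v j)))
        + (((a i j * b j i) ^ 2 : ℝ) : ℂ) • ketBra (prodVec (u i) (v j))) := by
    intro j
    split_ifs
    · simp
    · abel
  simp only [h2]
  rw [Finset.sum_add_distrib, hyi, Finset.smul_sum, ← Finset.sum_add_distrib,
    ← Finset.sum_add_distrib, ← Finset.sum_add_distrib]
  refine Finset.sum_congr rfl fun j _ => ?_
  by_cases hij : i = j
  · subst hij
    simp only [hR, if_true, ketBra]
    push_cast
    module
  · simp only [hR, if_neg hij]
    push_cast
    module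

/-- The part of `Φ(|Ψ⟩⟨Ψ|)` supported on the span of the product vectors `uᵢ ⊗ vⱼ`, for
`Ψ = ∑ μᵢ uᵢ ⊗ vᵢ` a Schmidt decomposition, where `Φ` is
taken in homogeneous form, with a coefficient `p` in front of `(Tr X) 𝟙`. Rays of the parameter
polyhedron have `p = 0`. -/
def schmidtBlock (u : ι → A → ℂ) (v : ι → B → ℂ) (μ : ι → ℝ) (p α β γ : ℝ) : Op A B :=
  ∑ i, ∑ j, ((p * ∑ k, μ k ^ 2 + α * μ j ^ 2 + β * μ i ^ 2 : ℝ) : ℂ) • ketBra (prodVec (u i) (v j))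
    + (γ : ℂ) • ketBra (∑ i, (μ i : ℂ) • prodVec (u i) (v i))

variable (u : ι → A → ℂ) (v : ι → B → ℂ) (μ : ι → ℝ)

theorem schmidtBlock_combo (s t p α β γ p' α' β' γ' : ℝ) :
    schmidtBlock u v μ (s * p + t * p') (s * α + t * α') (s * β + t * β') (s * γ + t * γ') =
      (s : ℂ) • schmidtBlock u v μ p α β γ + (t : ℂ) • schmidtBlock u v μ p' α' β' γ' := by
  have h : ∀ i j, ((((s * p + t * p') * ∑ k, μ k ^ 2 + (s * α + t * α') * μ j ^ 2
      + (s * β + t * β') * μ i ^ 2 : ℝ) : ℂ) • ketBra (prodVec (u i) (v j)) : Op A B) =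
      (s : ℂ) • (((p * ∑ k, μ k ^ 2 + α * μ j ^ 2 + β * μ i ^ 2 : ℝ) : ℂ) •
        ketBra (prodVec (u i) (v j))) +
      (t : ℂ) • (((p' * ∑ k, μ k ^ 2 + α' * μ j ^ 2 + β' * μ i ^ 2 : ℝ) : ℂ) •
        ketBra (prodVec (u i) (v j))) := by
    intro i j
    push_cast
    module
  simp only [schmidtBlock, h, Finset.sum_add_distrib, ← Finset.smul_sum]
  push_cast
  module

theorem sq_add_sq_le_sum [DecidableEq ι] {i j : ι} (hij : i ≠ j) :
    μ i ^ 2 + μ j ^ 2 ≤ ∑ k, μ k ^ 2 := by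
  rw [← Finset.sum_pair hij (f := fun k => μ k ^ 2)]
  exact Finset.sum_le_sum_of_subset_of_nonneg (Finset.subset_univ _) fun _ _ _ => sq_nonneg _

theorem sq_le_sum (i : ι) : μ i ^ 2 ≤ ∑ k, μ k ^ 2 :=
  Finset.single_le_sum (fun k _ => sq_nonneg (μ k)) (Finset.mem_univ i)

variable [Fintype A] [Fintype B] [DecidableEq ι]

/-- Twice the vertex `(-1, -1/2, 1/2)`. The product `aᵢⱼ bᵢⱼ = μⱼ` gives diagonal coefficients
`t - μᵢ²`, and the off-diagonal ones are `μᵢ² ≤ 2t - 2μⱼ² - μᵢ²`. -/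
theorem isSeparable_schmidtBlock_plus_left : IsSeparable (schmidtBlock u v μ 2 (-2) (-1) 1) := by
  refine isSeparable_diagonal_add u v μ (by norm_num) (fun _ _ => 1) (fun _ j => μ j) _
    (fun i j _ => by ring) (fun i j hij => ?_) fun i => ?_
  · have := sq_add_sq_le_sum μ hij
    linarith
  · have := sq_le_sum μ i
    simp only [one_mul]
    linarith

theorem isSeparable_schmidtBlock_plus_right : IsSeparable (schmidtBlock u v μ 2 (-1) (-2) 1) := by
  refine isSeparable_diagonal_add u v μ (by norm_num) (fun _ j => μ j) (fun _ _ => 1) _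
    (fun i j _ => by ring) (fun i j hij => ?_) fun i => ?_
  · have := sq_add_sq_le_sum μ hij
    linarith
  · have := sq_le_sum μ i
    simp only [mul_one]
    linarith

theorem isSeparable_schmidtBlock_minus_left : IsSeparable (schmidtBlock u v μ 1 (-1) 1 (-1)) := by
  refine isSeparable_diagonal_add u v μ (by norm_num) (fun _ _ => 1) (fun _ j => μ j) _
    (fun i j _ => by ring) (fun i j hij => ?_) fun i => ?_
  · have := sq_le_sum μ j
    linarith
  · simp only [one_mul]
    linarith

theorem isSeparable_schmidtBlock_minus_right : IsSeparable (schmidtBlock u v μ 1 1 (-1) (-1)) := by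
  refine isSeparable_diagonal_add u v μ (by norm_num) (fun _ j => μ j) (fun _ _ => 1) _
    (fun i j _ => by ring) (fun i j hij => ?_) fun i => ?_
  · have := sq_le_sum μ i
    linarith
  · simp only [mul_one]
    linarith

/-- With phase averages over pairs and `aᵢⱼ bᵢⱼ = μᵢ`, the diagonal coefficients would grow with the
number of indices; independent phases on all the indices at once avoid this. -/
theorem isSeparable_schmidtBlock_plusRay_left : IsSeparable (schmidtBlock u v μ 0 1 0 1) := by
  have h1 := isSeparable_ketBra_add_offDiag u (fun i => (μ i : ℂ) • v i) Finset.univ 0 0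
  have h2 : IsSeparable (∑ i, ((μ i ^ 2 : ℝ) : ℂ) • ketBra (prodVec (u i) (v i))) :=
    isSeparable_sum _ fun i _ => (isSeparable_ketBra_prodVec _ _).smul (sq_nonneg _)
  convert h1.add h2 using 1
  simp only [schmidtBlock, zero_prodVec, prodVec_zero, ketBra_zero, prodVec_smul, smul_zero,
    add_zero, zero_add, Finset.sum_const_zero, Complex.ofReal_one, one_smul]
  rw [add_comm, add_assoc, ← Finset.sum_add_distrib]
  congr 1
  refine Finset.sum_congr rfl fun i _ => ?_
  have hi : ((μ i ^ 2 : ℝ) : ℂ) • ketBra (prodVec (u i) (v i)) =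
      ∑ j, if i = j then ((μ i ^ 2 : ℝ) : ℂ) • ketBra (prodVec (u i) (v i)) else 0 := by
    simp
  rw [hi, ← Finset.sum_add_distrib]
  refine Finset.sum_congr rfl fun j _ => ?_
  by_cases hij : i = j
  · subst hij
    simp
  · rw [if_neg hij, if_neg hij, ketBra_smul]
    simp

theorem isSeparable_schmidtBlock_plusRay_right : IsSeparable (schmidtBlock u v μ 0 0 1 1) := by
  have h1 := isSeparable_ketBra_add_offDiag (fun i => (μ i : ℂ) • u i) v Finset.univ 0 0
  have h2 : IsSeparable (∑ i, ((μ i ^ 2 : ℝ) : ℂ) • ketBra (prodVec (u i) (v i))) :=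
    isSeparable_sum _ fun i _ => (isSeparable_ketBra_prodVec _ _).smul (sq_nonneg _)
  convert h1.add h2 using 1
  simp only [schmidtBlock, zero_prodVec, prodVec_zero, ketBra_zero, smul_prodVec,
    add_zero, zero_add, Finset.sum_const_zero, Complex.ofReal_one, one_smul]
  rw [add_comm, add_assoc, ← Finset.sum_add_distrib]
  congr 1
  refine Finset.sum_congr rfl fun i _ => ?_
  have hi : ((μ i ^ 2 : ℝ) : ℂ) • ketBra (prodVec (u i) (v i)) =
      ∑ j, if i = j then ((μ i ^ 2 : ℝ) : ℂ) • ketBra (prodVec (u i) (v i)) else 0 := by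
    simp
  rw [hi, ← Finset.sum_add_distrib]
  refine Finset.sum_congr rfl fun j _ => ?_
  by_cases hij : i = j
  · subst hij
    simp
  · rw [if_neg hij, if_neg hij, ketBra_smul]
    simp

/-- Here `aᵢⱼ bᵢⱼ = μᵢ`, so the diagonal coefficient is `μᵢ²` times the number of indices `j ≠ i`;
this is where the Schmidt rank, hence the smaller dimension, enters. -/
theorem isSeparable_schmidtBlock_minusRay_left {n : ℝ} (hn : (Fintype.card ι : ℝ) ≤ n)
    (hn1 : 1 ≤ n) : IsSeparable (schmidtBlock u v μ 0 n 0 (-1)) := by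
  refine isSeparable_diagonal_add u v μ (by norm_num) (fun _ _ => 1) (fun i _ => μ i) _
    (fun i j _ => by ring) (fun i j hij => ?_) fun i => ?_
  · have := mul_le_mul_of_nonneg_right hn1 (sq_nonneg (μ j))
    linarith
  · have := mul_le_mul_of_nonneg_right hn (sq_nonneg (μ i))
    simp only [one_mul, Finset.sum_const, Finset.card_univ, nsmul_eq_mul]
    linarith

theorem isSeparable_schmidtBlock_minusRay_right {n : ℝ} (hn : (Fintype.card ι : ℝ) ≤ n)
    (hn1 : 1 ≤ n) : IsSeparable (schmidtBlock u v μ 0 0 n (-1)) := by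
  refine isSeparable_diagonal_add u v μ (by norm_num) (fun i _ => μ i) (fun _ _ => 1) _
    (fun i j _ => by ring) (fun i j hij => ?_) fun i => ?_
  · have := mul_le_mul_of_nonneg_right hn1 (sq_nonneg (μ i))
    linarith
  · have := mul_le_mul_of_nonneg_right hn (sq_nonneg (μ i))
    simp only [mul_one, Finset.sum_const, Finset.card_univ, nsmul_eq_mul]
    linarith

end SchmidtDiagonal

/-! ### The polyhedron of parameters -/

section Polyhedron

/-- Points of the parameter polyhedron on the facet where the first parameter is `-1`. A set of
quadruples `(p, α, β, γ)` closed under nonnegative combinations contains them as soon as it contains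
the two vertices and the two extreme rays of that facet. -/
theorem facet_mem {S : ℝ → ℝ → ℝ → ℝ → Prop}
    (hS : ∀ {s t p α β γ p' α' β' γ' : ℝ}, 0 ≤ s → 0 ≤ t → S p α β γ → S p' α' β' γ' →
      S (s * p + t * p') (s * α + t * α') (s * β + t * β') (s * γ + t * γ'))
    {n : ℝ} (hn : 0 < n) (hv : S 2 (-2) (-1) 1) (hw : S 1 (-1) 1 (-1)) (hr : S 0 0 1 1)
    (hr' : S 0 0 n (-1)) {σ γ : ℝ} (h1 : γ + σ / n + 1 ≥ 0) (h2 : σ + γ + 1 ≥ 0)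
    (h3 : γ ≤ σ + 2) : S 1 (-1) (σ + 1) γ := by
  have hupper : S 1 (-1) (σ + 1) (σ + 2) := by
    have := hS (s := 1 / 2) (t := σ + 3 / 2) (by norm_num) (by linarith) hv hr
    convert this using 1 <;> ring
  obtain ⟨L, hL, hlower⟩ : ∃ L ≤ γ, S 1 (-1) (σ + 1) L := by
    -- Two edges bound the facet from below: the one joining its vertices, and a ray.
    rcases le_total σ 0 with hσ | hσ
    · refine ⟨-1 - σ, by linarith, ?_⟩
      have := hS (s := -σ / 3) (t := 1 + 2 * σ / 3) (by linarith) (by linarith) hv hw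
      convert this using 1 <;> ring
    · refine ⟨-1 - σ / n, by linarith, ?_⟩
      have := hS (s := 1) (t := σ / n) (by norm_num) (by positivity) hw hr'
      convert this using 1 <;> field_simp <;> ring
  -- The case `γ = σ + 2` is separate, as `L = σ + 2` is possible there and the weights of the
  -- interpolation would be quotients by zero.
  rcases h3.eq_or_lt with h | h
  · rwa [h]
  have hd : 0 < σ + 2 - L := by linarith
  have := hS (s := (γ - L) / (σ + 2 - L)) (t := (σ + 2 - γ) / (σ + 2 - L))
    (div_nonneg (by linarith) hd.le) (div_nonneg (by linarith) hd.le) hupper hlower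
  convert this using 1 <;> field_simp <;> ring

/-- Every point of the polyhedron lies on a segment of constant `α + β` and `γ` joining its facets
`α = -1` and `β = -1`. -/
theorem isSeparable_schmidtBlock {A B ι : Type*} [Fintype A] [Fintype B] [Fintype ι]
    [DecidableEq ι] (u : ι → A → ℂ) (v : ι → B → ℂ) (μ : ι → ℝ) {n : ℝ}
    (hn : (Fintype.card ι : ℝ) ≤ n) (hn1 : 1 ≤ n) {α β γ : ℝ} (hα : α ≥ -1) (hβ : β ≥ -1)
    (h1 : γ + (α + β) / n + 1 ≥ 0) (h2 : α + β + γ + 1 ≥ 0) (h3 : γ ≤ α + β + 2) :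
    IsSeparable (schmidtBlock u v μ 1 α β γ) := by
  have hcombo : ∀ {s t p α β γ p' α' β' γ' : ℝ}, 0 ≤ s → 0 ≤ t →
      IsSeparable (schmidtBlock u v μ p α β γ) → IsSeparable (schmidtBlock u v μ p' α' β' γ') →
      IsSeparable (schmidtBlock u v μ (s * p + t * p') (s * α + t * α') (s * β + t * β')
        (s * γ + t * γ')) := by
    intro s t p α β γ p' α' β' γ' hs ht h h'
    rw [schmidtBlock_combo]
    exact (h.smul hs).add (h'.smul ht)
  have hleft := facet_mem (S := fun p α β γ => IsSeparable (schmidtBlock u v μ p α β γ)) hcombo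
    (by linarith) (isSeparable_schmidtBlock_plus_left u v μ)
    (isSeparable_schmidtBlock_minus_left u v μ) (isSeparable_schmidtBlock_plusRay_right u v μ)
    (isSeparable_schmidtBlock_minusRay_right u v μ hn hn1) h1 h2 h3
  have hright := facet_mem (S := fun p α β γ => IsSeparable (schmidtBlock u v μ p β α γ)) hcombo
    (by linarith) (isSeparable_schmidtBlock_plus_right u v μ)
    (isSeparable_schmidtBlock_minus_right u v μ) (isSeparable_schmidtBlock_plusRay_left u v μ)
    (isSeparable_schmidtBlock_minusRay_left u v μ hn hn1) h1 h2 h3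
  have hd : 0 < α + β + 2 := by linarith
  have := hcombo (s := (β + 1) / (α + β + 2)) (t := (α + 1) / (α + β + 2))
    (div_nonneg (by linarith) hd.le) (div_nonneg (by linarith) hd.le) hleft hright
  convert this using 2 <;> field_simp <;> ring

end Polyhedron

/-! ### Sufficiency -/

section Sufficiency

variable {A B : Type*} [Fintype A] [Fintype B] [DecidableEq A] [DecidableEq B]

theorem Phi_apply (α β γ : ℝ) (X : Op A B) :
    Phi A B α β γ X = X.trace • (1 : Op A B) + (α : ℂ) • ((1 : Matrix A A ℂ) ⊗ₖ traceA X)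
      + (β : ℂ) • (traceB X ⊗ₖ (1 : Matrix B B ℂ)) + (γ : ℂ) • X :=
  rfl

theorem sum_kronecker_sum {A B ι κ : Type*} [Fintype ι] [Fintype κ] (P : ι → Matrix A A ℂ)
    (Q : κ → Matrix B B ℂ) : (∑ i, P i) ⊗ₖ (∑ j, Q j) = ∑ i, ∑ j, P i ⊗ₖ Q j := by
  ext p q
  simp [Matrix.kroneckerMap_apply, Matrix.sum_apply, Finset.sum_mul_sum]

theorem sum_add_smul_proj {A ι : Type*} [Fintype ι] (w : ι → A → ℂ) (μ : ι → ℝ) (t x : ℝ) :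
    ∑ j, ((t + x * μ j ^ 2 : ℝ) : ℂ) • proj (w j) =
      (t : ℂ) • ∑ j, proj (w j) + (x : ℂ) • ∑ j, ((μ j ^ 2 : ℝ) : ℂ) • proj (w j) := by
  simp only [Finset.smul_sum, ← Finset.sum_add_distrib]
  refine Finset.sum_congr rfl fun j _ => ?_
  push_cast
  module

theorem posSemidef_sum_add_smul_proj {A ι : Type*} [Fintype A] [Fintype ι] (w : ι → A → ℂ)
    (μ : ι → ℝ) {x : ℝ} (hx : x ≥ -1) :
    (∑ j, ((∑ k, μ k ^ 2 + x * μ j ^ 2 : ℝ) : ℂ) • proj (w j)).PosSemidef := by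
  refine Matrix.posSemidef_sum _ fun j _ => (posSemidef_proj (w j)).smul ?_
  have h1 := sq_le_sum μ j
  have h2 := mul_le_mul_of_nonneg_right hx (sq_nonneg (μ j))
  have h3 : 0 ≤ ∑ k, μ k ^ 2 + x * μ j ^ 2 := by linarith
  exact_mod_cast h3

/-- `Φ(|Ψ⟩⟨Ψ|)` is the sum of its Schmidt block and of three product terms involving the projectors
onto the orthogonal complements of the Schmidt vectors. -/
theorem Phi_ketBra_schmidt {ι : Type*} [Fintype ι] [DecidableEq ι] {u : ι → A → ℂ} {v : ι → B → ℂ}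
    (hu : IsOrthonormal u) (hv : IsOrthonormal v) (μ : ι → ℝ) (α β γ : ℝ) :
    Phi A B α β γ (ketBra (∑ i, (μ i : ℂ) • prodVec (u i) (v i))) =
      ((∑ k, μ k ^ 2 : ℝ) : ℂ) • ((1 - ∑ i, proj (u i)) ⊗ₖ (1 - ∑ j, proj (v j)))
      + (1 - ∑ i, proj (u i)) ⊗ₖ (∑ j, ((∑ k, μ k ^ 2 + α * μ j ^ 2 : ℝ) : ℂ) • proj (v j))
      + (∑ i, ((∑ k, μ k ^ 2 + β * μ i ^ 2 : ℝ) : ℂ) • proj (u i)) ⊗ₖ (1 - ∑ j, proj (v j))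
      + schmidtBlock u v μ 1 α β γ := by
  rw [Phi_apply, trace_schmidt hu hv, traceA_schmidt hu, traceB_schmidt u hv]
  set t : ℝ := ∑ k, μ k ^ 2
  set P := ∑ i, proj (u i) with hP
  set Q := ∑ j, proj (v j) with hQ
  set ρA := ∑ i, ((μ i ^ 2 : ℝ) : ℂ) • proj (u i) with hρA
  set ρB := ∑ j, ((μ j ^ 2 : ℝ) : ℂ) • proj (v j) with hρB
  have hblock : ∑ i, ∑ j, ((1 * t + α * μ j ^ 2 + β * μ i ^ 2 : ℝ) : ℂ) •
      ketBra (prodVec (u i) (v j)) =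
      (t : ℂ) • (P ⊗ₖ Q) + (α : ℂ) • (P ⊗ₖ ρB) + (β : ℂ) • (ρA ⊗ₖ Q) := by
    rw [hP, hQ, hρA, hρB, sum_kronecker_sum, sum_kronecker_sum, sum_kronecker_sum]
    simp only [Finset.smul_sum, ← Finset.sum_add_distrib]
    refine Finset.sum_congr rfl fun i _ => Finset.sum_congr rfl fun j _ => ?_
    rw [ketBra_prodVec, Matrix.kronecker_smul, Matrix.smul_kronecker]
    push_cast
    module
  have hone : (1 : Op A B) = (1 : Matrix A A ℂ) ⊗ₖ (1 : Matrix B B ℂ) :=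
    Matrix.one_kronecker_one.symm
  rw [schmidtBlock, hblock, sum_add_smul_proj v, sum_add_smul_proj u, ← hP, ← hQ, ← hρA, ← hρB,
    hone]
  ext p q
  simp only [Matrix.add_apply, Matrix.smul_apply, Matrix.kroneckerMap_apply, Matrix.sub_apply,
    smul_eq_mul]
  ring

theorem isSeparable_Phi_ketBra {α β γ : ℝ} {n : ℕ} (hn : n = min (Fintype.card A) (Fintype.card B))
    (hn1 : 1 ≤ n) (hα : α ≥ -1) (hβ : β ≥ -1) (h1 : γ + (α + β) / (n : ℝ) + 1 ≥ 0)
    (h2 : α + β + γ + 1 ≥ 0) (h3 : γ ≤ α + β + 2) (Ψ : A × B → ℂ) :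
    IsSeparable (Phi A B α β γ (ketBra Ψ)) := by
  obtain ⟨s, μ, u, v, hu, hv, rfl⟩ := exists_schmidt Ψ
  have hcard : (Fintype.card s : ℝ) ≤ n := by
    rw [hn]
    exact_mod_cast le_min hu.card_le hv.card_le
  rw [Phi_ketBra_schmidt hu hv]
  refine IsSeparable.add (IsSeparable.add (IsSeparable.add ?_ ?_) ?_) ?_
  · exact (isSeparable_kronecker hu.posSemidef_compl hv.posSemidef_compl).smul
      (Finset.sum_nonneg fun k _ => sq_nonneg (μ k))
  · exact isSeparable_kronecker hu.posSemidef_compl (posSemidef_sum_add_smul_proj v μ hα)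
  · exact isSeparable_kronecker (posSemidef_sum_add_smul_proj u μ hβ) hv.posSemidef_compl
  · exact isSeparable_schmidtBlock u v μ hcard (by exact_mod_cast hn1) hα hβ h1 h2 h3

open scoped MatrixOrder in
theorem exists_eq_sum_ketBra {X : Op A B} (hX : X.PosSemidef) :
    ∃ ψ : A × B → A × B → ℂ, X = ∑ k, ketBra (ψ k) := by
  obtain ⟨Y, rfl⟩ := CStarAlgebra.nonneg_iff_eq_star_mul_self.mp hX.nonneg
  refine ⟨fun k p => star (Y k p), ?_⟩
  ext p q
  simp [Matrix.mul_apply, ketBra, Matrix.sum_apply, Matrix.vecMulVec_apply,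
    Matrix.star_eq_conjTranspose]

theorem isSeparable_map_of_ketBra {Ξ : Op A B →ₗ[ℂ] Op A B}
    (h : ∀ Ψ, IsSeparable (Ξ (ketBra Ψ))) {X : Op A B} (hX : X.PosSemidef) :
    IsSeparable (Ξ X) := by
  obtain ⟨ψ, rfl⟩ := exists_eq_sum_ketBra hX
  rw [map_sum]
  exact isSeparable_sum _ fun k _ => h (ψ k)

theorem isEntanglementAnnihilating_of_ketBra {Ξ : Op A B →ₗ[ℂ] Op A B}
    (h : ∀ Ψ, IsSeparable (Ξ (ketBra Ψ))) : IsEntanglementAnnihilating Ξ :=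
  ⟨fun _ hX => (isSeparable_map_of_ketBra h hX).posSemidef,
    fun _ hR => isSeparable_map_of_ketBra h hR.1⟩

theorem IsEntanglementAnnihilating.isPPTInducing {A B : Type*} [Fintype A]
    [Fintype B] {Ξ : Op A B →ₗ[ℂ] Op A B}
    (h : IsEntanglementAnnihilating Ξ) : IsPPTInducing Ξ := by
  intro X hX
  obtain ⟨c, hc0, hc⟩ : ∃ c : ℝ, 0 ≤ c ∧ X.trace = c := by
    have := hX.trace_nonneg
    exact ⟨X.trace.re, (Complex.nonneg_iff.1 this).1,
      Complex.ext rfl (by simpa using (Complex.nonneg_iff.1 this).2.symm)⟩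
  rcases hc0.eq_or_lt with h0 | h0
  · have : X = 0 := hX.trace_eq_zero_iff.1 (by rw [hc, ← h0, Complex.ofReal_zero])
    rw [this, map_zero]
    exact Matrix.PosSemidef.zero
  · have hstate : IsState (((c⁻¹ : ℝ) : ℂ) • X) := by
      refine ⟨hX.smul (by exact_mod_cast inv_nonneg.2 hc0), ?_⟩
      rw [Matrix.trace_smul, hc, smul_eq_mul, ← Complex.ofReal_mul, inv_mul_cancel₀ h0.ne',
        Complex.ofReal_one]
    have hsep := h.2 _ hstate
    rw [map_smul] at hsep
    exact (hsep.of_smul (inv_pos.2 h0)).partialTranspose.posSemidef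

end Sufficiency

/-! ### Necessity -/

section Necessity

variable {A B ι : Type*} [Fintype A] [Fintype B] [DecidableEq A] [DecidableEq B] [Fintype ι]
  [DecidableEq ι]

theorem posSemidef_ketBra {A B : Type*} [Fintype A] [Fintype B] (Ψ : A × B → ℂ) :
    (ketBra Ψ).PosSemidef :=
  Matrix.posSemidef_vecMulVec_self_star Ψ

theorem isOrthonormal_single {A ι : Type*} [Fintype A] [DecidableEq A] [DecidableEq ι] {f : ι → A}
    (hf : Function.Injective f) :
    IsOrthonormal fun i => (Pi.single (f i) 1 : A → ℂ) := by
  intro i j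
  simp [Pi.single_apply, hf.eq_iff, eq_comm (a := j)]

/-- The vector `∑ μᵢ |f i⟩ ⊗ |g i⟩`. -/
def testVec (f : ι → A) (g : ι → B) (μ : ι → ℝ) : A × B → ℂ :=
  ∑ i, (μ i : ℂ) • prodVec (Pi.single (f i) 1) (Pi.single (g i) 1)

theorem Phi_testVec_apply {f : ι → A} {g : ι → B} (hf : Function.Injective f)
    (hg : Function.Injective g) (μ : ι → ℝ) (α β γ : ℝ) (i j k l : ι) :
    Phi A B α β γ (ketBra (testVec f g μ)) (f i, g j) (f k, g l) =
      (((if i = k ∧ j = l then ∑ x, μ x ^ 2 + α * μ j ^ 2 + β * μ i ^ 2 else 0)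
        + γ * ((if i = j then μ i else 0) * (if k = l then μ k else 0)) : ℝ) : ℂ) := by
  have hvec : ∀ i j, testVec f g μ (f i, g j) = ((if i = j then μ i else 0 : ℝ) : ℂ) := by
    intro i j
    by_cases hij : i = j <;>
      simp [testVec, prodVec, Finset.sum_apply, Pi.single_apply, hf.eq_iff, hg.eq_iff, hij]
  have hA : ∀ j l, traceA (ketBra (testVec f g μ)) (g j) (g l) =
      ((if j = l then μ j ^ 2 else 0 : ℝ) : ℂ) := by
    intro j l
    rw [testVec, traceA_schmidt (isOrthonormal_single hf)]
    by_cases hij : j = l <;>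
      simp [Matrix.sum_apply, proj, Matrix.vecMulVec_apply, Pi.single_apply, hg.eq_iff, hij]
  have hB : ∀ i k, traceB (ketBra (testVec f g μ)) (f i) (f k) =
      ((if i = k then μ i ^ 2 else 0 : ℝ) : ℂ) := by
    intro i k
    rw [testVec, traceB_schmidt _ (isOrthonormal_single hg)]
    by_cases hij : i = k <;>
      simp [Matrix.sum_apply, proj, Matrix.vecMulVec_apply, Pi.single_apply, hf.eq_iff, hij]
  have ht : (ketBra (testVec f g μ)).trace = ((∑ x, μ x ^ 2 : ℝ) : ℂ) :=
    trace_schmidt (isOrthonormal_single hf) (isOrthonormal_single hg) μ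
  have hk : ketBra (testVec f g μ) (f i, g j) (f k, g l) =
      (((if i = j then μ i else 0) * (if k = l then μ k else 0) : ℝ) : ℂ) := by
    rw [ketBra, Matrix.vecMulVec_apply, Pi.star_apply, hvec, hvec, Complex.ofReal_mul]
    simp
  simp only [Phi_apply, ht, Matrix.add_apply, Matrix.smul_apply, Matrix.kroneckerMap_apply,
    Matrix.one_apply, hA, hB, hk, Prod.mk.injEq, hf.eq_iff, hg.eq_iff, smul_eq_mul]
  generalize (if i = j then μ i else 0) * (if k = l then μ k else 0) = z
  by_cases hik : i = k <;> by_cases hjl : j = l <;> simp [hik, hjl]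

/-- Positivity tested on the product vector `|00⟩`: the diagonal entries at `|10⟩`, `|01⟩` and
`|00⟩` of the image are nonnegative. -/
theorem IsPositiveMap.params_nonneg_of_two {f : Fin 2 → A} {g : Fin 2 → B}
    (hf : Function.Injective f) (hg : Function.Injective g) {α β γ : ℝ}
    (h : IsPositiveMap (Phi A B α β γ)) : α ≥ -1 ∧ β ≥ -1 ∧ α + β + γ + 1 ≥ 0 := by
  have key : ∀ i j, 0 ≤ Phi A B α β γ (ketBra (testVec f g ![1, 0])) (f i, g j) (f i, g j) :=
    fun i j => (h _ (posSemidef_ketBra _)).diag_nonneg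
  simp only [Phi_testVec_apply hf hg] at key
  have h00 := key 0 0
  have h01 := key 0 1
  have h10 := key 1 0
  norm_cast at h00 h01 h10
  simp [Fin.sum_univ_two] at h00 h01 h10
  exact ⟨by linarith, by linarith, by linarith⟩

/-- Positivity tested on the maximally entangled vector `∑ |f i⟩ ⊗ |g i⟩`. -/
theorem IsPositiveMap.gamma_ge [Nonempty ι] {f : ι → A} {g : ι → B}
    (hf : Function.Injective f) (hg : Function.Injective g) {α β γ : ℝ}
    (h : IsPositiveMap (Phi A B α β γ)) : γ + (α + β) / (Fintype.card ι : ℝ) + 1 ≥ 0 := by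
  have h1 := ((h _ (posSemidef_ketBra (testVec f g fun _ => 1))).submatrix
    fun i => (f i, g i)).dotProduct_mulVec_nonneg fun _ => 1
  simp only [dotProduct, Matrix.mulVec, Matrix.submatrix_apply, Phi_testVec_apply hf hg,
    Pi.star_apply, star_one, one_mul, mul_one] at h1
  norm_cast at h1
  simp [Finset.sum_add_distrib] at h1
  have hn : (0 : ℝ) < Fintype.card ι := by exact_mod_cast Fintype.card_pos
  have h2 : γ + (α + β) / (Fintype.card ι : ℝ) + 1 = (Fintype.card ι * Fintype.card ι +
    Fintype.card ι * α + Fintype.card ι * β + Fintype.card ι * (Fintype.card ι * γ)) /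
    Fintype.card ι ^ 2 := by
    field_simp
    ring
  rw [h2]
  exact div_nonneg h1 (sq_nonneg _)

/-- The partial transpose of the image of `|00⟩ + |11⟩`, tested on the antisymmetric vector
`|01⟩ - |10⟩`. -/
theorem IsPPTInducing.gamma_le {f : Fin 2 → A} {g : Fin 2 → B} (hf : Function.Injective f)
    (hg : Function.Injective g) {α β γ : ℝ} (h : IsPPTInducing (Phi A B α β γ)) :
    γ ≤ α + β + 2 := by
  have h1 := ((h _ (posSemidef_ketBra (testVec f g fun _ => 1))).submatrix
    ![(f 0, g 1), (f 1, g 0)]).dotProduct_mulVec_nonneg ![1, -1]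
  have hpt : ∀ (Y : Op A B) a b a' b',
    partialTranspose Y (a, b) (a', b') = Y (a, b') (a', b) := fun _ _ _ _ _ => rfl
  simp only [dotProduct, Matrix.mulVec, Matrix.submatrix_apply, Fin.sum_univ_two,
    LinearMap.comp_apply, Matrix.cons_val_zero, Matrix.cons_val_one, hpt,
    Phi_testVec_apply hf hg, Pi.star_apply, star_one, star_neg] at h1
  norm_cast at h1
  simp at h1
  norm_cast at h1
  linarith

end Necessity

end Bipartite

theorem mainTheorem2 (dA dB : ℕ) (hA : 2 ≤ dA) (hB : 2 ≤ dB) :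
    (∀ α β γ : ℝ,
      List.TFAE [
        Bipartite.IsEntanglementAnnihilating (Bipartite.Phi (Fin dA) (Fin dB) α β γ),
        Bipartite.IsPositiveMap (Bipartite.Phi (Fin dA) (Fin dB) α β γ) ∧
          Bipartite.IsPPTInducing (Bipartite.Phi (Fin dA) (Fin dB) α β γ),
        Bipartite.IsPositiveMap (Bipartite.Phi (Fin dA) (Fin dB) α β γ) ∧ γ ≤ α + β + 2,
        α ≥ -1 ∧ β ≥ -1 ∧ γ + (α + β) / ((min dA dB : ℕ) : ℝ) + 1 ≥ 0 ∧
          α + β + γ + 1 ≥ 0 ∧ γ ≤ α + β + 2]) ∧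
    (∀ Ψ : Fin dA × Fin dB → ℂ, star Ψ ⬝ᵥ Ψ = 1 →
      Bipartite.IsSeparable
        ((2 : ℂ) • (1 : Bipartite.Op (Fin dA) (Fin dB))
          - (2 : ℂ) • ((1 : Matrix (Fin dA) (Fin dA) ℂ) ⊗ₖ
              Bipartite.traceA (Bipartite.ketBra Ψ))
          - Bipartite.traceB (Bipartite.ketBra Ψ) ⊗ₖ (1 : Matrix (Fin dB) (Fin dB) ℂ)
          + Bipartite.ketBra Ψ)) := by
  have hn : 2 ≤ min dA dB := le_min hA hB
  have hcard : min dA dB = min (Fintype.card (Fin dA)) (Fintype.card (Fin dB)) := by simp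
  refine ⟨fun α β γ => ?_, fun Ψ hΨ => ?_⟩
  · tfae_have 1 → 2 := fun h => ⟨h.1, h.isPPTInducing⟩
    tfae_have 2 → 3 := fun h =>
      ⟨h.1, h.2.gamma_le (Fin.castLE_injective hA) (Fin.castLE_injective hB)⟩
    tfae_have 3 → 4 := by
      rintro ⟨hpos, hγ⟩
      obtain ⟨h1, h2, h3⟩ := hpos.params_nonneg_of_two (Fin.castLE_injective hA)
        (Fin.castLE_injective hB)
      have : Nonempty (Fin (min dA dB)) := ⟨⟨0, by omega⟩⟩
      have h4 := hpos.gamma_ge (Fin.castLE_injective (min_le_left dA dB))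
        (Fin.castLE_injective (min_le_right dA dB))
      rw [Fintype.card_fin] at h4
      exact ⟨h1, h2, h4, h3, hγ⟩
    tfae_have 4 → 1 := by
      rintro ⟨hα, hβ, h1, h2, h3⟩
      exact Bipartite.isEntanglementAnnihilating_of_ketBra
        (Bipartite.isSeparable_Phi_ketBra hcard (by omega) hα hβ h1 h2 h3)
    tfae_finish
  · -- The operator is twice the image of `|Ψ⟩⟨Ψ|` under the vertex `Φ[-1, -1/2, 1/2]`.
    have hn' : (2 : ℝ) ≤ (min dA dB : ℕ) := by exact_mod_cast hn
    have hn3 : (3 / 2 : ℝ) / (min dA dB : ℕ) ≤ 3 / 2 :=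
      div_le_self (by norm_num) (by linarith)
    have h := Bipartite.isSeparable_Phi_ketBra (α := -1) (β := -1 / 2) (γ := 1 / 2) hcard
      (by omega) (by norm_num) (by norm_num)
      (by
        rw [show (-1 + -1 / 2 : ℝ) = -(3 / 2) by norm_num, neg_div]
        linarith)
      (by norm_num) (by norm_num) Ψ
    have htr : (Bipartite.ketBra Ψ).trace = 1 := by
      rw [Bipartite.ketBra, Matrix.trace_vecMulVec, dotProduct_comm, hΨ]
    convert h.smul (c := 2) (by norm_num) using 1
    rw [Bipartite.Phi_apply, htr]
    push_cast
    module
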